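/- Let $V$ be a finite-dimensional vector space over $\mathbb R$ or over $\mathbb Q_p$ ($p$ a prime), with its unique Hausdorff vector space topology. A *contraction* of $V$ is a continuous automorphism $T$ of the topological group $(V,+)$ such that $T^n x\to 0$ for every $x\in V$. For a Borel probability measure $\mu$ on $V$ let $T(\mu)(B)=\mu(T^{-1}(B))$. Let $*$ denote convolution, and let $\nu^{n}$ be the $n$-th convolution power of $\nu$. Call $\mu$ *infinitely divisible* if for every integer $n\ge 1$ there is a Borel probability measure $\nu$ on $V$ with $\nu^{n}=\mu$. A Borel probability measure $\nu$ is a *factor* of $\mu$ if $\mu=\nu*\rho$ for some Borel probability measure $\rho$, and $\mu$ *has no idempotent factors* if the only factor $\nu$ of $\mu$ with $\nu*\nu=\nu$ is the Dirac measure $\delta_0$. Let $T_1,\dots,T_m$ be contractions of $V$ with $T_iT_j=T_jT_i$ for all $1\le i,j\le m$, and let $\mu$ be a Borel probability measure on $V$ such that $$\mu=T_1(\mu)*T_2(\mu)*\cdots*T_m(\mu)$$ (for $m=0$ the right-hand side is $\delta_0$). Then $\mu$ is infinitely divisible and has no idempotent factors. In particular, every autophage measure on $V$, that is, every Borel probability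 measure $\mu$ on $V$ such that $\mu=T(\mu)*S(\mu)$ for some contractions $T,S$ of $V$ with $TS=ST$, is infinitely divisible and has no idempotent factors. -/

import Mathlib

open MeasureTheory Filter Topology

namespace Autophage

/-- The topological additive group `V` is (the additive group of) a finite-dimensional vector
space over `ℝ` or over `ℚ_p` for some prime `p`, with its vector space topology
(for Hausdorff `V` the topology is then the unique Hausdorff vector space topology). -/
def IsFiniteDimRealOrPadic (V : Type*) [AddCommGroup V] [TopologicalSpace V] : Prop :=
  (∃ _ : Module ℝ V, ContinuousSMul ℝ V ∧ FiniteDimensional ℝ V) ∨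
  (∃ (p : ℕ) (_ : Fact p.Prime) (_ : Module ℚ_[p] V),
    ContinuousSMul ℚ_[p] V ∧ FiniteDimensional ℚ_[p] V)

section

variable {V : Type*} [AddCommGroup V] [TopologicalSpace V]

/-- A contraction: a continuous automorphism `T` of the topological group `V` (with continuous
inverse) such that `T ^ n x → 0` for every `x`. -/
def IsContraction (T : V ≃ₜ+ V) : Prop :=
  ∀ x : V, Tendsto (fun n : ℕ => (⇑T)^[n] x) atTop (𝓝 0)

end

section

variable {V : Type*} [AddCommGroup V] [MeasurableSpace V]

/-- The convolution `μ₁ ∗ ⋯ ∗ μₘ` of a list of measures; the empty convolution is the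
Dirac measure at `0`. -/
noncomputable def convList (l : List (Measure V)) : Measure V :=
  l.foldr (fun μ ν => μ ∗ ν) (Measure.dirac 0)

/-- The `n`-th convolution power of a measure. -/
noncomputable def convPow (μ : Measure V) (n : ℕ) : Measure V :=
  convList (List.replicate n μ)

/-- For every `n ≥ 1`, `μ` has an `n`-th convolution root among the probability measures. -/
def InfinitelyDivisible (μ : Measure V) : Prop :=
  ∀ n : ℕ, 1 ≤ n → ∃ ν : Measure V, IsProbabilityMeasure ν ∧ convPow ν n = μ

/-- `ν` is a factor of `μ`: `μ = ν ∗ ρ` for probability measures `ν`, `ρ`. -/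
def IsFactor (ν μ : Measure V) : Prop :=
  IsProbabilityMeasure ν ∧ ∃ ρ : Measure V, IsProbabilityMeasure ρ ∧ μ = ν ∗ ρ

/-- `μ` has no idempotent factors other than the trivial one, the Dirac measure at `0`. -/
def NoIdempotentFactors (μ : Measure V) : Prop :=
  ∀ ν : Measure V, IsFactor ν μ → ν ∗ ν = ν → ν = Measure.dirac 0

/-- `μ` is autophage: `μ = T(μ) ∗ S(μ)` for two commuting contractions `T`, `S`. -/
def IsAutophage [TopologicalSpace V] (μ : Measure V) : Prop :=
  ∃ T S : V ≃ₜ+ V, IsContraction T ∧ IsContraction S ∧ (∀ x, T (S x) = S (T x)) ∧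
    μ = μ.map T ∗ μ.map S

end

end Autophage

/-! Probability measures on `V` form a commutative monoid under convolution, written additively,
with `δ_0` as zero. The push-forwards `t_i` of the `T_i` generate a commutative semiring of
endomorphisms, and `∑ t_i` fixes `μ`.

Divisibility: for a prime `q`, `(∑ t_i)^(q^k) = ∑ t_i^(q^k) + q Q_k`. Applied to `μ`, this exhibits
`Q_k μ` as a `q`-th root up to a remainder tending to `δ_0`, because the `T_i` contract. Induction
on the prime factors gives approximate `n`-th roots for every `n` (`exists_approximate_root`). Such
roots stay in a compact set (`exists_isCompact_root`), and a cluster point is an exact root.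

No idempotent factors: a zero of the Fourier transform of `μ` at `χ` forces a zero at some `χ ∘
T_i`. Iteration gives zeros at characters tending pointwise to `1`, where the transform tends to
`1`, a contradiction (`charInt_ne_zero`). The transform of an idempotent factor takes only the
values `0` and `1` and cannot vanish, so it is constantly `1`. -/

namespace Autophage

/-! ### The convolution monoid of probability measures. -/

section ConvolutionMonoid

variable {V : Type*} [AddCommGroup V] [MeasurableSpace V]

noncomputable instance [MeasurableAdd₂ V] : Add (ProbabilityMeasure V) where
  add μ ν := ⟨(μ : Measure V) ∗ (ν : Measure V), inferInstance⟩

noncomputable instance : Zero (ProbabilityMeasure V) where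
  zero := diracProba 0

lemma toMeasure_zero : ((0 : ProbabilityMeasure V) : Measure V) = Measure.dirac 0 := rfl

lemma zero_eq_diracProba : (0 : ProbabilityMeasure V) = diracProba 0 := rfl

variable [MeasurableAdd₂ V]

/-- Probability measures form a commutative monoid under convolution. -/
noncomputable instance : AddCommMonoid (ProbabilityMeasure V) where
  add_assoc μ ν ρ := Subtype.ext (Measure.conv_assoc _ _ _)
  zero_add μ := Subtype.ext (Measure.dirac_zero_conv _)
  add_zero μ := Subtype.ext (Measure.conv_dirac_zero _)
  add_comm μ ν := Subtype.ext (Measure.conv_comm _ _)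
  nsmul := nsmulRec

lemma toMeasure_add (μ ν : ProbabilityMeasure V) :
    ((μ + ν : ProbabilityMeasure V) : Measure V) = (μ : Measure V) ∗ (ν : Measure V) := rfl

lemma diracProba_add (x y : V) : diracProba (x + y) = diracProba x + diracProba y :=
  Subtype.ext (Measure.dirac_conv_dirac x y).symm

/-- `x ↦ δ_x` as a monoid homomorphism into the convolution monoid. -/
noncomputable def diracHom : V →+ ProbabilityMeasure V where
  toFun := diracProba
  map_zero' := rfl
  map_add' := diracProba_add

lemma convList_map_toMeasure (l : List (ProbabilityMeasure V)) :
    convList (l.map ProbabilityMeasure.toMeasure) = (l.sum : ProbabilityMeasure V) := by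
  induction l with
  | nil => rfl
  | cons μ l ih => rw [List.sum_cons, toMeasure_add, ← ih]; rfl

lemma convPow_toMeasure (ν : ProbabilityMeasure V) (n : ℕ) :
    convPow (ν : Measure V) n = (n • ν : ProbabilityMeasure V) := by
  rw [← List.sum_replicate, ← convList_map_toMeasure, List.map_replicate]; rfl

/-- Complements of sums of sets have small mass under a convolution if the complements of
the summands have. -/
lemma conv_compl_le (μ ν : ProbabilityMeasure V) {A B C : Set V} (hC : MeasurableSet C)
    (h : ∀ a ∈ A, ∀ b ∈ B, a + b ∈ C) :
    ((μ + ν : ProbabilityMeasure V) : Measure V) Cᶜ ≤ (μ : Measure V) Aᶜ + (ν : Measure V) Bᶜ := by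
  rw [toMeasure_add, Measure.conv, Measure.map_apply (by fun_prop) hC.compl]
  have hsub : (fun x : V × V => x.1 + x.2) ⁻¹' Cᶜ ⊆ Aᶜ ×ˢ Set.univ ∪ Set.univ ×ˢ Bᶜ := by
    rintro ⟨a, b⟩ hab
    by_contra hn
    simp only [Set.mem_union, Set.mem_prod, Set.mem_compl_iff, Set.mem_univ, and_true, true_and,
      not_or, not_not] at hn
    exact hab (h a hn.1 b hn.2)
  refine (measure_mono hsub).trans ((measure_union_le _ _).trans ?_)
  simp [Measure.prod_prod]

/-- Some translate of a set carries at least as much mass for a factor as the set itself does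
for the convolution. -/
lemma exists_le_add_dirac (ν ρ : ProbabilityMeasure V) {K : Set V} (hK : MeasurableSet K) :
    ∃ y : V, ((ν + diracProba y : ProbabilityMeasure V) : Measure V) Kᶜ
      ≤ ((ν + ρ : ProbabilityMeasure V) : Measure V) Kᶜ := by
  have h1 : ∀ σ : ProbabilityMeasure V, ((ν + σ : ProbabilityMeasure V) : Measure V) Kᶜ
      = ∫⁻ y, (ν : Measure V) ((fun x => x + y) ⁻¹' Kᶜ) ∂(σ : Measure V) := by
    intro σ
    rw [toMeasure_add, Measure.conv, Measure.map_apply (by fun_prop) hK.compl,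
      Measure.prod_apply_symm (measurable_add hK.compl)]
    rfl
  have hm : Measurable fun y => (ν : Measure V) ((fun x => x + y) ⁻¹' Kᶜ) :=
    measurable_measure_prodMk_right (measurable_add hK.compl)
  -- The mass for `ν + ρ` is the `ρ`-average of the masses for the translates, so some translate
  -- does not exceed it.
  obtain ⟨y, hy⟩ := exists_le_lintegral (μ := (ρ : Measure V)) hm.aemeasurable
  refine ⟨y, ?_⟩
  rw [h1 ρ, h1]
  refine le_trans (le_of_eq ?_) hy
  exact lintegral_dirac' _ hm

end ConvolutionMonoid

/-! ### Push-forwards as endomorphisms of the convolution monoid. -/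

section Push

variable {V : Type*} [AddCommGroup V] [TopologicalSpace V] [IsTopologicalAddGroup V]
  [MeasurableSpace V] [BorelSpace V] [SecondCountableTopology V]

/-- Push-forward under a continuous automorphism, as an endomorphism of the convolution monoid. -/
noncomputable def push (T : V ≃ₜ+ V) : AddMonoid.End (ProbabilityMeasure V) where
  toFun μ := μ.map (f := T) T.continuous_toFun.measurable.aemeasurable
  map_zero' := Subtype.ext <| by
    have h : Measurable T := T.continuous_toFun.measurable
    change (Measure.dirac (0 : V)).map T = Measure.dirac 0
    rw [Measure.map_dirac' h, map_zero]
  map_add' μ ν := Subtype.ext <| by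
    have h : Measurable T := T.continuous_toFun.measurable
    exact Measure.map_conv_addMonoidHom (T : V →+ V) h

lemma toMeasure_push (T : V ≃ₜ+ V) (μ : ProbabilityMeasure V) :
    (push T μ : Measure V) = (μ : Measure V).map T := rfl

lemma push_mul_comm {T S : V ≃ₜ+ V} (h : ∀ x, T (S x) = S (T x)) :
    push T * push S = push S * push T := by
  ext1 μ
  apply Subtype.ext
  have hT : Measurable T := T.continuous_toFun.measurable
  have hS : Measurable S := S.continuous_toFun.measurable
  change ((μ : Measure V).map S).map T = ((μ : Measure V).map T).map S
  rw [Measure.map_map hT hS, Measure.map_map hS hT]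
  congr 1
  exact funext h

lemma toMeasure_push_pow (T : V ≃ₜ+ V) (n : ℕ) (μ : ProbabilityMeasure V) :
    ((push T ^ n) μ : Measure V) = (μ : Measure V).map (⇑T)^[n] := by
  have hT : Measurable T := T.continuous_toFun.measurable
  induction n with
  | zero => simp
  | succ n ih =>
    rw [pow_succ']
    change ((push T ^ n) μ : Measure V).map T = _
    rw [ih, Measure.map_map hT (hT.iterate n), Function.iterate_succ']

lemma end_sum_apply {M ι : Type*} [AddCommMonoid M] (s : Finset ι) (f : ι → AddMonoid.End M)
    (x : M) : (∑ i ∈ s, f i) x = ∑ i ∈ s, f i x :=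
  AddMonoidHom.finsetSum_apply f s x

lemma convList_ofFn_map {m : ℕ} (T : Fin m → (V ≃ₜ+ V)) (μ : ProbabilityMeasure V) :
    convList (List.ofFn fun i => (μ : Measure V).map (T i))
      = ((∑ i, push (T i)) μ : ProbabilityMeasure V) := by
  rw [end_sum_apply, ← List.sum_ofFn, ← convList_map_toMeasure, List.map_ofFn]
  rfl

lemma continuousAdd_probabilityMeasure [TopologicalSpace.PseudoMetrizableSpace V] :
    ContinuousAdd (ProbabilityMeasure V) where
  continuous_add := (ProbabilityMeasure.continuous_map (f := fun p : V × V => p.1 + p.2)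
    (by fun_prop)).comp ProbabilityMeasure.continuous_prod

end Push

open scoped Pointwise

/-! ### Tightness of factors and compactness of approximate roots. -/

section Tightness

/-- Two sets whose complements have mass at most `1/4` intersect. -/
lemma exists_mem_inter_of_compl_le {V : Type*} [MeasurableSpace V]
    (σ : ProbabilityMeasure V) {A B : Set V}
    (hA : (σ : Measure V) Aᶜ ≤ 4⁻¹) (hB : (σ : Measure V) Bᶜ ≤ 4⁻¹) : ∃ x, x ∈ A ∧ x ∈ B := by
  by_contra! hn
  have huniv : (Set.univ : Set V) ⊆ Aᶜ ∪ Bᶜ := by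
    intro x _
    by_cases hx : x ∈ A
    · exact Or.inr (hn x hx)
    · exact Or.inl hx
  have h1 : (1 : ENNReal) ≤ 4⁻¹ + 4⁻¹ := by
    calc (1 : ENNReal) = (σ : Measure V) Set.univ := by simp
      _ ≤ (σ : Measure V) Aᶜ + (σ : Measure V) Bᶜ :=
        (measure_mono huniv).trans (measure_union_le _ _)
      _ ≤ 4⁻¹ + 4⁻¹ := add_le_add hA hB
  have h2 := (ENNReal.toReal_le_toReal (by simp) (by simp)).2 h1
  rw [ENNReal.toReal_add (by simp) (by simp)] at h2
  norm_num at h2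

variable {V : Type*} [TopologicalSpace V] [MeasurableSpace V] [BorelSpace V] [PolishSpace V]

/-- The converse half of Prokhorov's theorem, valid since `V` is Polish. -/
lemma exists_isCompact_compl_le {C : Set (ProbabilityMeasure V)} (hC : IsCompact C)
    {ε : ENNReal} (hε : 0 < ε) :
    ∃ K : Set V, IsCompact K ∧ ∀ ν ∈ C, (ν : Measure V) Kᶜ ≤ ε := by
  let _ := TopologicalSpace.upgradeIsCompletelyMetrizable V
  obtain ⟨K, hK, h⟩ := isTightMeasureSet_iff_exists_isCompact_measure_compl_le.1
    (isTightMeasureSet_of_isCompact_closure (S := C) (by rwa [hC.isClosed.closure_eq])) ε hε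
  exact ⟨K, hK, fun ν hν => h _ ⟨ν, hν, rfl⟩⟩

lemma exists_isCompact_superset {C : Set (ProbabilityMeasure V)}
    (h : ∀ ε : ENNReal, 0 < ε → ∃ K : Set V, IsCompact K ∧ ∀ ν ∈ C, (ν : Measure V) Kᶜ ≤ ε) :
    ∃ D : Set (ProbabilityMeasure V), IsCompact D ∧ C ⊆ D := by
  refine ⟨closure C, isCompact_closure_of_isTightMeasureSet ?_, subset_closure⟩
  refine isTightMeasureSet_iff_exists_isCompact_measure_compl_le.2 fun ε hε => ?_
  obtain ⟨K, hK, hK'⟩ := h ε hε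
  refine ⟨K, hK, ?_⟩
  rintro _ ⟨ν, hν, rfl⟩
  exact hK' ν hν

variable [AddCommGroup V] [IsTopologicalAddGroup V]

instance : ContinuousAdd (ProbabilityMeasure V) := continuousAdd_probabilityMeasure

lemma add_dirac_neg (ν : ProbabilityMeasure V) (x : V) :
    ν + diracProba x + diracProba (-x) = ν := by
  rw [add_assoc, ← diracProba_add, add_neg_cancel, ← zero_eq_diracProba, add_zero]

/-- The factors of a probability measure are relatively compact up to translation. -/
lemma exists_isCompact_factor_add_dirac (μ : ProbabilityMeasure V) :
    ∃ D : Set (ProbabilityMeasure V), IsCompact D ∧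
      ∀ ν ρ : ProbabilityMeasure V, ν + ρ = μ → ∃ x : V, ν + diracProba x ∈ D := by
  obtain ⟨K₀, hK₀, hμK₀⟩ := exists_isCompact_compl_le (isCompact_singleton (x := μ))
    (ε := 4⁻¹) (by simp)
  replace hμK₀ := hμK₀ μ rfl
  -- Factors normalized by a translation, so that most of their mass lies in the fixed compact set
  -- `K₀`.
  let C : Set (ProbabilityMeasure V) :=
    {σ | (σ : Measure V) K₀ᶜ ≤ 4⁻¹ ∧ ∃ ρ : ProbabilityMeasure V, σ + ρ = μ}
  have hshift : ∀ ν ρ : ProbabilityMeasure V, ν + ρ = μ → ∀ K : Set V, IsCompact K →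
      ∃ y, ((ν + diracProba y : ProbabilityMeasure V) : Measure V) Kᶜ ≤ (μ : Measure V) Kᶜ := by
    intro ν ρ h K hK
    rw [← h]
    exact exists_le_add_dirac ν ρ hK.measurableSet
  obtain ⟨D, hD, hCD⟩ := exists_isCompact_superset (C := C) <| by
    intro ε hε
    obtain ⟨K, hK, hμK⟩ := exists_isCompact_compl_le (isCompact_singleton (x := μ))
      (ε := min ε 4⁻¹) (by simp [hε])
    replace hμK := hμK μ rfl
    -- Some translate of `σ` by `y` almost lives on `K`. It also has mass at least `3/4` on `K₀ +
    -- y`, so `K` meets `K₀ + y` and `-y ∈ K₀ - K`. Undoing the translation places `σ` almost on `K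
    -- + (K₀ - K)`.
    have hL : IsCompact (K + (K₀ - K)) := hK.add (sub_eq_add_neg K₀ K ▸ hK₀.add hK.neg)
    refine ⟨_, hL, ?_⟩
    rintro σ ⟨hσ, ρ, hρ⟩
    obtain ⟨y, hy⟩ := hshift σ ρ hρ K hK
    have hy' := hy.trans hμK
    obtain ⟨z, hz, hz'⟩ := exists_mem_inter_of_compl_le (σ + diracProba y) (A := K)
      (B := (fun x => x - y) ⁻¹' K₀) (hy'.trans (min_le_right _ _)) <| by
        refine (conv_compl_le σ (diracProba y) (A := K₀) (B := {y}) ?_ ?_).trans ?_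
        · exact hK₀.measurableSet.preimage (by fun_prop)
        · rintro a ha _ rfl
          simpa using ha
        · simpa using hσ
    rw [← add_dirac_neg σ y]
    refine (conv_compl_le (σ + diracProba y) (diracProba (-y)) (A := K) (B := {-y})
      hL.measurableSet ?_).trans ?_
    · rintro a ha _ rfl
      refine Set.add_mem_add ha ?_
      refine ⟨z - y, hz', z, hz, by simp⟩
    · simpa using hy'.trans (min_le_left _ _)
  refine ⟨D, hD, fun ν ρ h => ?_⟩
  obtain ⟨y, hy⟩ := hshift ν ρ h K₀ hK₀
  refine ⟨y, hCD ⟨hy.trans hμK₀, ρ + diracProba (-y), ?_⟩⟩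
  rw [add_add_add_comm, ← diracProba_add, add_neg_cancel, ← zero_eq_diracProba, add_zero, h]

/-- Translating a fixed measure into a compact set is possible only by a compact set of
translations. -/
lemma exists_isCompact_of_add_dirac_mem (μ : ProbabilityMeasure V)
    {D : Set (ProbabilityMeasure V)} (hD : IsCompact D) :
    ∃ X : Set V, IsCompact X ∧ ∀ x, μ + diracProba x ∈ D → x ∈ X := by
  obtain ⟨K₀, hK₀, hμK₀⟩ := exists_isCompact_compl_le (isCompact_singleton (x := μ))
    (ε := 4⁻¹) (by simp)
  obtain ⟨K, hK, hDK⟩ := exists_isCompact_compl_le hD (ε := 4⁻¹) (by simp)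
  refine ⟨K - K₀, sub_eq_add_neg K K₀ ▸ hK.add hK₀.neg, fun x hx => ?_⟩
  obtain ⟨z, hz, hz'⟩ := exists_mem_inter_of_compl_le (μ + diracProba x) (A := K)
    (B := (fun y => y - x) ⁻¹' K₀) (hDK _ hx) <| by
      refine (conv_compl_le μ (diracProba x) (A := K₀) (B := {x}) ?_ ?_).trans ?_
      · exact hK₀.measurableSet.preimage (by fun_prop)
      · rintro a ha _ rfl
        simpa using ha
      · simpa using hμK₀ μ rfl
  exact ⟨z, hz, z - x, hz', by simp⟩

/-- If multiplication by `n` on `V` has a continuous left inverse, the approximate `n`-th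
convolution roots of `μ` with remainders in a compact set are relatively compact. -/
theorem exists_isCompact_root {n : ℕ} (hn : n ≠ 0) {d : V → V} (hd : Continuous d)
    (hdn : ∀ x, d (n • x) = x) (μ : ProbabilityMeasure V) {C : Set (ProbabilityMeasure V)}
    (hC : IsCompact C) :
    ∃ D : Set (ProbabilityMeasure V), IsCompact D ∧
      ∀ ν ρ : ProbabilityMeasure V, ρ ∈ C → n • ν + ρ = μ → ν ∈ D := by
  obtain ⟨D₁, hD₁, h₁⟩ := exists_isCompact_factor_add_dirac μ
  have hD₂ : IsCompact ((fun σ : ProbabilityMeasure V => n • σ) '' D₁ + C) :=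
    (hD₁.image (continuous_nsmul n)).add hC
  obtain ⟨X, hX, h₂⟩ := exists_isCompact_of_add_dirac_mem μ hD₂
  refine ⟨D₁ + (fun x => diracProba (-(d x))) '' X,
    hD₁.add (hX.image (continuous_diracProba.comp hd.neg)), fun ν ρ hρ h => ?_⟩
  obtain ⟨k, rfl⟩ := Nat.exists_eq_succ_of_ne_zero hn
  obtain ⟨x, hx⟩ := h₁ ν (k • ν + ρ) (by rw [← h, Nat.succ_eq_add_one, succ_nsmul', add_assoc])
  -- Translating `ν` by `x` translates `n • ν + ρ = μ` by `n • x`. The result lies in a compact set,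
  -- which confines `n • x` and hence `x = d (n • x)`.
  have hxX : (k + 1) • x ∈ X := by
    apply h₂
    refine ⟨(k + 1) • (ν + diracProba x), ⟨_, hx, rfl⟩, ρ, hρ, ?_⟩
    have hdx : diracProba ((k + 1) • x) = (k + 1) • diracProba x := map_nsmul diracHom _ _
    rw [hdx, ← h, nsmul_add, add_right_comm]
  refine ⟨ν + diracProba x, hx, _, ⟨_, hxX, rfl⟩, ?_⟩
  have := hdn x
  simp only [Nat.succ_eq_add_one] at this
  simp only [this]
  exact add_dirac_neg ν x

/-- If the powers of `T` tend to `0` uniformly on compact sets, they push measures from a compact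
set of measures to the Dirac measure at `0`. -/
theorem tendsto_push_pow {T : V ≃ₜ+ V}
    (hT : ∀ K : Set V, IsCompact K → ∀ U ∈ 𝓝 (0 : V), ∀ᶠ n : ℕ in atTop, ∀ x ∈ K, (⇑T)^[n] x ∈ U)
    {C : Set (ProbabilityMeasure V)} (hC : IsCompact C) {ν : ℕ → ProbabilityMeasure V}
    (hν : ∀ k, ν k ∈ C) {e : ℕ → ℕ} (he : Tendsto e atTop atTop) :
    Tendsto (fun k => (push T ^ e k) (ν k)) atTop (𝓝 0) := by
  refine tendsto_of_forall_isOpen_le_liminf' fun G hG => ?_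
  rw [toMeasure_zero]
  by_cases h0 : (0 : V) ∈ G
  swap
  · rw [Measure.dirac_apply' _ hG.measurableSet]
    simp [h0]
  rw [Measure.dirac_apply_of_mem h0]
  refine le_of_forall_lt fun c hc => ?_
  obtain ⟨c', hcc', hc'⟩ := exists_between hc
  obtain ⟨K, hK, hCK⟩ := exists_isCompact_compl_le hC (ε := 1 - c') (by simpa using hc')
  refine hcc'.trans_le (le_liminf_of_le (by isBoundedDefault) ?_)
  filter_upwards [he.eventually (hT K hK G (hG.mem_nhds h0))] with k hk
  have hTm : Measurable T := T.continuous_toFun.measurable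
  rw [toMeasure_push_pow, Measure.map_apply (hTm.iterate _) hG.measurableSet]
  refine le_trans ?_ (measure_mono hk)
  have h1 := hCK _ (hν k)
  rw [prob_compl_eq_one_sub hK.measurableSet] at h1
  exact (ENNReal.sub_le_sub_iff_left hc'.le ENNReal.one_ne_top).1 h1

end Tightness

/-! ### Convolution roots from the Frobenius congruence. -/

section Divisibility

/-- The "freshman's dream" modulo `q`. It is phrased with an explicit `Q` because a semiring has no
subtraction. -/
lemma exists_sum_pow_prime_pow_eq {A ι : Type*} [CommSemiring A] {q : ℕ} (hq : q.Prime) (k : ℕ)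
    (s : Finset ι) (t : ι → A) :
    ∃ Q : A, (∑ i ∈ s, t i) ^ q ^ k = ∑ i ∈ s, t i ^ q ^ k + q * Q := by
  classical
  induction s using Finset.induction_on with
  | empty => exact ⟨0, by simp [hq.ne_zero]⟩
  | insert a s ha ih =>
    obtain ⟨Q, hQ⟩ := ih
    obtain ⟨r, hr⟩ := exists_add_pow_prime_pow_eq hq (t a) (∑ i ∈ s, t i) k
    refine ⟨Q + t a * (∑ i ∈ s, t i) * r, ?_⟩
    rw [Finset.sum_insert ha, Finset.sum_insert ha, hr, hQ]
    ring

variable {V : Type*} [AddCommGroup V] [TopologicalSpace V] [IsTopologicalAddGroup V]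
  [MeasurableSpace V] [BorelSpace V] [PolishSpace V]

/-- If `μ = n • ν k + ρ k` with `ρ k → 0`, then the `ν k` stay in a compact set. -/
lemma exists_isCompact_of_tendsto {n : ℕ} (hn : n ≠ 0)
    (hd : ∃ d : V → V, Continuous d ∧ ∀ x, d (n • x) = x)
    {μ : ProbabilityMeasure V} {ν ρ : ℕ → ProbabilityMeasure V}
    (h : ∀ k, n • ν k + ρ k = μ) (hρ : Tendsto ρ atTop (𝓝 0)) :
    ∃ D : Set (ProbabilityMeasure V), IsCompact D ∧ ∀ k, ν k ∈ D := by
  obtain ⟨d, hdc, hd⟩ := hd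
  obtain ⟨D, hD, h'⟩ := exists_isCompact_root hn hdc hd μ hρ.isCompact_insert_range
  exact ⟨D, hD, fun k => h' _ (ρ k) (Or.inr ⟨k, rfl⟩) (h k)⟩

lemma exists_nsmul_eq_of_tendsto {n : ℕ} (hn : n ≠ 0)
    (hd : ∃ d : V → V, Continuous d ∧ ∀ x, d (n • x) = x)
    {μ : ProbabilityMeasure V} {ν ρ : ℕ → ProbabilityMeasure V}
    (h : ∀ k, n • ν k + ρ k = μ) (hρ : Tendsto ρ atTop (𝓝 0)) :
    ∃ σ : ProbabilityMeasure V, n • σ = μ := by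
  obtain ⟨D, hD, hνD⟩ := exists_isCompact_of_tendsto hn hd h hρ
  -- Along an ultrafilter the approximate roots converge by compactness, and `n • ν k + ρ k = μ`
  -- passes to the limit with `ρ k → 0`.
  let 𝒰 : Ultrafilter ℕ := Ultrafilter.of atTop
  have h𝒰 : (𝒰 : Filter ℕ) ≤ atTop := Ultrafilter.of_le atTop
  obtain ⟨σ, -, hσ⟩ := hD.ultrafilter_le_nhds (𝒰.map ν) <| by
    rw [le_principal_iff]
    exact mem_map.2 (Eventually.of_forall hνD)
  have hσ' : Tendsto ν 𝒰 (𝓝 σ) := hσ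
  have hlim := (((continuous_nsmul n).tendsto σ).comp hσ').add (hρ.mono_left h𝒰)
  simp only [Function.comp_def, h, add_zero] at hlim
  exact ⟨σ, tendsto_nhds_unique hlim tendsto_const_nhds⟩

open scoped IsMulCommutative in
/-- Approximate `n`-th convolution roots of `μ`, obtained from the Frobenius congruence for powers
of `∑ i, t i` in the commutative semiring generated by the `t i`. -/
theorem exists_approximate_root {m : ℕ} {T : Fin m → (V ≃ₜ+ V)}
    (hd : ∀ n : ℕ, n ≠ 0 → ∃ d : V → V, Continuous d ∧ ∀ x, d (n • x) = x)
    (hT : ∀ i, ∀ K : Set V, IsCompact K → ∀ U ∈ 𝓝 (0 : V), ∀ᶠ n : ℕ in atTop,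
      ∀ x ∈ K, (⇑(T i))^[n] x ∈ U)
    (hcomm : ∀ i j x, T i (T j x) = T j (T i x)) {μ : ProbabilityMeasure V}
    (hμ : (∑ i, push (T i)) μ = μ) (n : ℕ) (hn : n ≠ 0) :
    ∃ P R : ℕ → Subsemiring.closure (Set.range fun i => push (T i)),
      (∀ k, n • (P k).1 μ + (R k).1 μ = μ) ∧ Tendsto (fun k => (R k).1 μ) atTop (𝓝 0) := by
  have := Subsemiring.isMulCommutative_closure (s := Set.range fun i => push (T i)) <| by
    rintro _ ⟨i, rfl⟩ _ ⟨j, rfl⟩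
    exact push_mul_comm (hcomm i j)
  let A := Subsemiring.closure (Set.range fun i => push (T i))
  let t : Fin m → A := fun i => ⟨push (T i), Subsemiring.subset_closure ⟨i, rfl⟩⟩
  have hS : ∀ N : ℕ, ((∑ i, t i) ^ N).1 μ = μ := by
    intro N
    induction N with
    | zero => rfl
    | succ N ih =>
      rw [pow_succ]
      change ((∑ i, t i) ^ N).1 ((∑ i, t i : A).1 μ) = μ
      have : (∑ i, t i : A).1 = ∑ i, push (T i) := by
        simp only [AddSubmonoidClass.coe_finsetSum, t]
      rw [this, hμ, ih]
  have hcast : ∀ (l : ℕ) (a : A) (x : ProbabilityMeasure V), (l * a : A).1 x = l • a.1 x := by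
    intro l a x
    induction l with
    | zero => rw [Nat.cast_zero, zero_mul, zero_smul]; rfl
    | succ l ih => rw [Nat.cast_succ, add_mul, one_mul, succ_nsmul, ← ih]; rfl
  induction n using induction_on_primes with
  | zero => exact absurd rfl hn
  | one =>
    refine ⟨fun _ => 1, fun _ => 0, fun k => ?_, tendsto_const_nhds⟩
    rw [one_smul]
    exact add_zero _
  | prime_mul q n hq ih =>
    have hn0 : n ≠ 0 := right_ne_zero_of_mul hn
    obtain ⟨P, R, hPR, hR⟩ := ih hn0
    choose Q hQ using fun k => exists_sum_pow_prime_pow_eq hq k Finset.univ t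
    -- The measures pushed by `T i ^ q ^ k` vary with `k`; the compact set containing them supplies
    -- the uniformity needed for `hF`.
    obtain ⟨D, hD, hPD⟩ := exists_isCompact_of_tendsto hn0 (hd n hn0) hPR hR
    have hF : Tendsto (fun k => ∑ i, (push (T i) ^ q ^ k) ((P k).1 μ)) atTop (𝓝 0) := by
      rw [← Finset.sum_const_zero (s := (Finset.univ : Finset (Fin m)))]
      exact tendsto_finsetSum _ fun i _ =>
        tendsto_push_pow (hT i) hD hPD (tendsto_pow_atTop_atTop_of_one_lt hq.one_lt)
    have hF' : ∀ k, (P k * ∑ i, t i ^ q ^ k).1 μ = ∑ i, (push (T i) ^ q ^ k) ((P k).1 μ) := by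
      intro k
      rw [mul_comm, ← end_sum_apply]
      change (∑ i, t i ^ q ^ k : A).1 ((P k).1 μ) = _
      simp only [AddSubmonoidClass.coe_finsetSum, SubmonoidClass.coe_pow, t]
    -- Multiply `n P + R` by `(∑ t_i)^(q^k)`, which fixes `μ`, and expand that power only in the `n
    -- P` term: `qn P Q` splits off and the rest is the new remainder.
    refine ⟨fun k => P k * Q k, fun k => n * (P k * ∑ i, t i ^ q ^ k) + R k * (∑ i, t i) ^ q ^ k,
      fun k => ?_, ?_⟩
    · have key : ((q * n : ℕ) : A) * (P k * Q k)
          + (n * (P k * ∑ i, t i ^ q ^ k) + R k * (∑ i, t i) ^ q ^ k)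
          = (n * P k + R k) * (∑ i, t i) ^ q ^ k := by
        rw [add_mul, hQ k]
        push_cast
        ring
      rw [← hcast]
      have h1 := congrArg (fun a : A => a.1 μ) key
      refine h1.trans ?_
      change (n * P k + R k : A).1 (((∑ i, t i) ^ q ^ k).1 μ) = μ
      rw [hS]
      change (n * P k : A).1 μ + (R k).1 μ = μ
      rw [hcast, hPR]
    · have h1 : ∀ k, (n * (P k * ∑ i, t i ^ q ^ k) + R k * (∑ i, t i) ^ q ^ k : A).1 μ
          = n • (∑ i, (push (T i) ^ q ^ k) ((P k).1 μ)) + (R k).1 μ := by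
        intro k
        change (n * (P k * ∑ i, t i ^ q ^ k) : A).1 μ + (R k).1 (((∑ i, t i) ^ q ^ k).1 μ) = _
        rw [hS, hcast, hF']
      simp only [h1]
      simpa using (((continuous_nsmul n).tendsto 0).comp hF).add hR

end Divisibility

/-! ### Fourier transforms: nonvanishing and uniqueness at the constant `1`. -/

section Characters

variable {V : Type*} [AddCommGroup V] [TopologicalSpace V]

lemma continuous_coe_char {χ : AddChar V Circle} (hχ : Continuous χ) :
    Continuous fun x => (χ x : ℂ) :=
  continuous_subtype_val.comp hχ

/-- The composition `T (s 0) ∘ ⋯ ∘ T (s (N - 1))`. -/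
def iterComp {ι : Type*} (T : ι → (V ≃ₜ+ V)) (s : ℕ → ι) : ℕ → V → V
  | 0 => id
  | N + 1 => iterComp T s N ∘ T (s N)

variable [MeasurableSpace V] [BorelSpace V]

/-- The Fourier transform of a probability measure at a character. -/
noncomputable def charInt {V : Type*} [AddCommGroup V] [MeasurableSpace V]
    (χ : AddChar V Circle) (μ : ProbabilityMeasure V) : ℂ :=
  ∫ x, (χ x : ℂ) ∂(μ : Measure V)

lemma integrable_char {χ : AddChar V Circle} (hχ : Continuous χ) (μ : Measure V)
    [IsProbabilityMeasure μ] : Integrable (fun x => (χ x : ℂ)) μ := by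
  have hm : Measurable fun x => (χ x : ℂ) := (continuous_coe_char hχ).measurable
  exact Integrable.of_bound hm.aestronglyMeasurable 1
    (Eventually.of_forall fun x => (Circle.norm_coe (χ x)).le)

lemma charInt_zero (χ : AddChar V Circle) (hχ : Continuous χ) : charInt χ 0 = 1 := by
  have hm : StronglyMeasurable fun x => (χ x : ℂ) :=
    (continuous_coe_char hχ).stronglyMeasurable
  rw [charInt, toMeasure_zero, integral_dirac' _ _ hm]
  simp

variable [IsTopologicalAddGroup V] [SecondCountableTopology V]

lemma charInt_add {χ : AddChar V Circle} (hχ : Continuous χ) (μ ν : ProbabilityMeasure V) :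
    charInt χ (μ + ν) = charInt χ μ * charInt χ ν := by
  rw [charInt, toMeasure_add, integral_conv (integrable_char hχ _)]
  simp only [AddChar.map_add_eq_mul, Circle.coe_mul, integral_const_mul, integral_mul_const]
  rfl

lemma charInt_sum {χ : AddChar V Circle} (hχ : Continuous χ) {ι : Type*} (s : Finset ι)
    (μ : ι → ProbabilityMeasure V) : charInt χ (∑ i ∈ s, μ i) = ∏ i ∈ s, charInt χ (μ i) := by
  classical
  induction s using Finset.induction_on with
  | empty => simp [charInt_zero χ hχ]
  | insert a s ha ih => rw [Finset.sum_insert ha, Finset.prod_insert ha, charInt_add hχ, ih]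

lemma charInt_push {χ : AddChar V Circle} (hχ : Continuous χ) (T : V ≃ₜ+ V)
    (μ : ProbabilityMeasure V) :
    charInt χ (push T μ) = charInt (χ.compAddMonoidHom (T : V →+ V)) μ := by
  have hm : Measurable fun x => (χ x : ℂ) := (continuous_coe_char hχ).measurable
  have hT : Measurable T := T.continuous_toFun.measurable
  rw [charInt, toMeasure_push, integral_map hT.aemeasurable hm.aestronglyMeasurable]
  rfl

/-- The Fourier transform of a measure with `μ = ∑ i, T i μ` vanishes nowhere, if long products of
the `T i` tend to `0`. -/
theorem charInt_ne_zero {m : ℕ} {T : Fin m → (V ≃ₜ+ V)}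
    (hT : ∀ (s : ℕ → Fin m) (x : V), Tendsto (fun N => iterComp T s N x) atTop (𝓝 0))
    {μ : ProbabilityMeasure V} (hμ : (∑ i, push (T i)) μ = μ)
    {χ : AddChar V Circle} (hχ : Continuous χ) : charInt χ μ ≠ 0 := by
  intro h0
  let Z := {ψ : AddChar V Circle // Continuous ψ ∧ charInt ψ μ = 0}
  have hstep : ∀ ψ : Z, ∃ i : Fin m, charInt (ψ.1.compAddMonoidHom (T i : V →+ V)) μ = 0 := by
    rintro ⟨ψ, hψ, hψ0⟩
    rw [← hμ, end_sum_apply, charInt_sum hψ, Finset.prod_eq_zero_iff] at hψ0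
    obtain ⟨i, -, hi⟩ := hψ0
    exact ⟨i, by rw [← charInt_push hψ, hi]⟩
  -- A choice of index at every zero turns the zero `χ` into an infinite sequence of zeros.
  choose c hc using hstep
  let next : Z → Z := fun ψ => ⟨ψ.1.compAddMonoidHom (T (c ψ) : V →+ V),
    ψ.2.1.comp (T (c ψ)).continuous_toFun, hc ψ⟩
  let ψ : ℕ → Z := fun N => next^[N] ⟨χ, hχ, h0⟩
  let s : ℕ → Fin m := fun N => c (ψ N)
  have hψ : ∀ N x, (ψ N).1 x = χ (iterComp T s N x) := by
    intro N
    induction N with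
    | zero => intro x; rfl
    | succ N ih =>
      intro x
      have : ψ (N + 1) = next (ψ N) := Function.iterate_succ_apply' _ _ _
      rw [this]
      exact ih (T (s N) x)
  have hlim : Tendsto (fun N => charInt (ψ N).1 μ) atTop (𝓝 (∫ _, (1 : ℂ) ∂(μ : Measure V))) := by
    refine tendsto_integral_of_dominated_convergence (fun _ => (1 : ℝ)) (fun N => ?_)
      (integrable_const _) (fun N => ?_) (Eventually.of_forall fun x => ?_)
    · exact (integrable_char (ψ N).2.1 _).aestronglyMeasurable
    · exact Eventually.of_forall fun x => (Circle.norm_coe _).le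
    · simp only [hψ]
      have h1 : Tendsto (fun y => (χ y : ℂ)) (𝓝 0) (𝓝 1) := by
        have := (continuous_coe_char hχ).tendsto 0
        simpa using this
      exact h1.comp (hT s x)
  simp only [(ψ _).2.2, integral_const, probReal_univ, one_smul] at hlim
  exact zero_ne_one (tendsto_nhds_unique tendsto_const_nhds hlim)

/-- A probability measure whose Fourier transform is constantly `1` is trivial, if the characters
separate points from `0`. -/
theorem eq_zero_of_charInt_eq_one {V : Type*} [AddCommGroup V] [TopologicalSpace V]
    [MeasurableSpace V] [BorelSpace V] [SecondCountableTopology V]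
    (hsep : ∀ x : V, x ≠ 0 → ∃ χ : AddChar V Circle, Continuous χ ∧ χ x ≠ 1)
    {ν : ProbabilityMeasure V} (hν : ∀ χ : AddChar V Circle, Continuous χ → charInt χ ν = 1) :
    ν = 0 := by
  have hae : ∀ χ : AddChar V Circle, Continuous χ → (ν : Measure V) {x | χ x ≠ 1} = 0 := by
    intro χ hχ
    have hire : Integrable (fun x => (χ x : ℂ).re) (ν : Measure V) := (integrable_char hχ _).re
    have hint : Integrable (fun x => 1 - (χ x : ℂ).re) (ν : Measure V) :=
      (integrable_const _).sub hire
    have hnn : 0 ≤ fun x => 1 - (χ x : ℂ).re := fun x => by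
      have := Complex.re_le_norm (χ x : ℂ)
      rw [Circle.norm_coe] at this
      exact sub_nonneg.2 this
    -- The integrand is nonnegative with integral `0`, so `Re χ = 1` almost everywhere; on the unit
    -- circle this means `χ = 1`.
    have h0 : ∫ x, (1 - (χ x : ℂ).re) ∂(ν : Measure V) = 0 := by
      have hre : ∫ x, (χ x : ℂ).re ∂(ν : Measure V) = (charInt χ ν).re :=
        integral_re (integrable_char hχ _)
      rw [integral_sub (integrable_const _) hire, hre]
      simp [hν χ hχ]
    have := (integral_eq_zero_iff_of_nonneg hnn hint).1 h0
    refine measure_mono_null ?_ this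
    intro x hx hx'
    apply hx
    have hre : (χ x : ℂ).re = 1 := by
      have : 1 - (χ x : ℂ).re = 0 := hx'
      linarith
    have hnorm : (χ x : ℂ).re ^ 2 + (χ x : ℂ).im ^ 2 = 1 := by
      have := Circle.normSq_coe (χ x)
      rw [Complex.normSq_apply] at this
      linarith
    apply Circle.ext
    apply Complex.ext
    · simpa using hre
    · rw [hre] at hnorm
      have : (χ x : ℂ).im ^ 2 = 0 := by linarith
      simpa using this
  -- Each nonzero point has a null neighbourhood, and second countability makes the whole complement
  -- null.
  have hcompl : (ν : Measure V) {0}ᶜ = 0 := by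
    refine measure_null_of_locally_null _ fun x hx => ?_
    obtain ⟨χ, hχ, hx1⟩ := hsep x hx
    refine ⟨{y | χ y ≠ 1}, mem_nhdsWithin_of_mem_nhds ?_, hae χ hχ⟩
    exact (isOpen_ne_fun hχ continuous_const).mem_nhds hx1
  apply Subtype.ext
  have h1 : ∀ᵐ x ∂(ν : Measure V), x = 0 := hcompl
  change (ν : Measure V) = Measure.dirac 0
  have h2 : (ν : Measure V).map id = (ν : Measure V).map fun _ => 0 := Measure.map_congr h1
  rw [Measure.map_id, Measure.map_const] at h2
  rw [h2]
  simp

end Characters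

/-! ### Infinite products of commuting topologically nilpotent elements. -/

section NormedRing

lemma tendsto_card_filter_range {p : ℕ → Prop} [DecidablePred p] (hp : {n | p n}.Infinite) :
    Tendsto (fun N => ((Finset.range N).filter p).card) atTop atTop := by
  refine tendsto_atTop.2 fun b => ?_
  obtain ⟨t, ht, hcard⟩ := hp.exists_subset_card_eq b
  filter_upwards [eventually_ge_atTop (t.sup id + 1)] with N hN
  rw [← hcard]
  refine Finset.card_le_card fun n hn => ?_
  refine Finset.mem_filter.2 ⟨Finset.mem_range.2 ?_, ht hn⟩
  have : n ≤ t.sup id := Finset.le_sup (f := id) hn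
  omega

/-- In a commutative normed ring, infinite products of finitely many elements whose powers tend
to `0` tend to `0`. -/
lemma tendsto_prod_range_zero {R ι : Type*} [NormedCommRing R] [Fintype ι] [DecidableEq ι]
    {a : ι → R} (ha : ∀ i, Tendsto (fun n => a i ^ n) atTop (𝓝 0)) (s : ℕ → ι) :
    Tendsto (fun N => ∏ n ∈ Finset.range N, a (s n)) atTop (𝓝 0) := by
  -- Some index `j` occurs infinitely often. Its power tends to `0`, while the powers of the other
  -- elements stay bounded.
  obtain ⟨j, hj⟩ := Finite.exists_infinite_fiber s
  have hj' : {n | s n = j}.Infinite := Set.infinite_coe_iff.1 hj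
  have hbdd : ∀ i, ∃ C, ∀ n, ‖a i ^ n‖ ≤ C := fun i => by
    obtain ⟨C, hC⟩ := (ha i).norm.bddAbove_range
    exact ⟨C, fun n => hC ⟨n, rfl⟩⟩
  choose C hC using hbdd
  let c : ι → ℕ → ℕ := fun i N => ((Finset.range N).filter fun n => s n = i).card
  have hprod : ∀ N, ∏ n ∈ Finset.range N, a (s n) = ∏ i, a i ^ c i N := by
    intro N
    rw [← Finset.prod_fiberwise (Finset.range N) s]
    refine Finset.prod_congr rfl fun i _ => ?_
    rw [← Finset.prod_const]
    refine Finset.prod_congr rfl fun n hn => ?_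
    rw [(Finset.mem_filter.1 hn).2]
  have hle : ∀ N, ‖∏ n ∈ Finset.range N, a (s n)‖
      ≤ ‖a j ^ c j N‖ * ∏ i ∈ Finset.univ.erase j, C i := by
    intro N
    rw [hprod]
    refine (Finset.norm_prod_le' _ ⟨j, Finset.mem_univ j⟩ _).trans ?_
    rw [← Finset.mul_prod_erase _ _ (Finset.mem_univ j)]
    refine mul_le_mul_of_nonneg_left ?_ (norm_nonneg _)
    exact Finset.prod_le_prod (fun _ _ => norm_nonneg _) fun i _ => hC i _
  refine squeeze_zero_norm hle ?_
  have h1 := ((ha j).comp (tendsto_card_filter_range hj')).norm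
  simpa using h1.mul_const (∏ i ∈ Finset.univ.erase j, C i)

/-- The subring generated by the `a i` is commutative and carries the induced norm, so the
commutative case applies there. -/
lemma tendsto_prod_of_commute {R ι : Type*} [NormedRing R] [Fintype ι] [DecidableEq ι]
    {a : ι → R} (hcomm : ∀ i j, a i * a j = a j * a i)
    (ha : ∀ i, Tendsto (fun n => a i ^ n) atTop (𝓝 0)) (s : ℕ → ι) {p : ℕ → R} (hp0 : p 0 = 1)
    (hp : ∀ N, p (N + 1) = p N * a (s N)) : Tendsto p atTop (𝓝 0) := by
  have hc := Subring.isMulCommutative_closure (s := Set.range a) <| by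
    rintro _ ⟨i, rfl⟩ _ ⟨j, rfl⟩
    exact hcomm i j
  let A := Subring.closure (Set.range a)
  let _ : NormedCommRing A :=
    { (inferInstance : NormedRing A) with mul_comm := fun x y => hc.is_comm.comm x y }
  let b : ι → A := fun i => ⟨a i, Subring.subset_closure ⟨i, rfl⟩⟩
  have hb : ∀ i, Tendsto (fun n => b i ^ n) atTop (𝓝 0) := fun i => by
    rw [tendsto_subtype_rng]
    exact ha i
  have h := tendsto_prod_range_zero hb s
  rw [tendsto_subtype_rng] at h
  refine h.congr fun N => ?_
  induction N with
  | zero => rw [hp0]; rfl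
  | succ N ih =>
    rw [hp, ← ih, Finset.prod_range_succ]
    rfl

end NormedRing

/-! ### Nontrivial unitary characters of `ℝ` and `ℚ_p`. -/

section FieldCharacters

/-- The embedding `ℚ/ℤ → ℝ/ℤ`. -/
noncomputable def ratCircleToReal : AddCircle (1 : ℚ) →+ AddCircle (1 : ℝ) :=
  QuotientAddGroup.map _ _ (Rat.castHom ℝ : ℚ →+ ℝ) <| by
    rintro _ ⟨n, rfl⟩
    exact ⟨n, by simp⟩

lemma ratCircleToReal_injective : Function.Injective ratCircleToReal := by
  rw [injective_iff_map_eq_zero]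
  intro x
  induction x using QuotientAddGroup.induction_on with
  | H q =>
    intro h
    have h' : ((q : ℝ) : AddCircle (1 : ℝ)) = 0 := h
    rw [AddCircle.coe_eq_zero_iff] at h'
    obtain ⟨n, hn⟩ := h'
    refine (AddCircle.coe_eq_zero_iff 1).2 ⟨n, ?_⟩
    have : ((n : ℚ) : ℝ) = q := by simpa using hn
    simpa using Rat.cast_injective this

/-- There is a nontrivial continuous unitary character of `ℚ_p`. -/
lemma exists_padic_character (p : ℕ) [Fact p.Prime] :
    ∃ ψ : AddChar ℚ_[p] Circle, Continuous ψ ∧ ∃ c, ψ c ≠ 1 := by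
  let U : AddSubgroup ℚ_[p] := (PadicInt.subring p).toAddSubgroup
  have hU : IsOpen (U : Set ℚ_[p]) := by
    have : (U : Set ℚ_[p]) = Metric.closedBall 0 1 := by
      ext x
      simp only [mem_closedBall_zero_iff]
      rfl
    rw [this]
    exact IsUltrametricDist.isOpen_closedBall _ one_ne_zero
  -- As `ℤ_p` is open, every character of `ℚ_p/ℤ_p` is continuous. One that is nontrivial at the
  -- class of `p⁻¹` exists algebraically, with values in `ℚ/ℤ`.
  have hd : DiscreteTopology (ℚ_[p] ⧸ U) := QuotientAddGroup.discreteTopology hU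
  have hne : (((p : ℚ_[p])⁻¹ : ℚ_[p]) : ℚ_[p] ⧸ U) ≠ 0 := by
    rw [Ne, QuotientAddGroup.eq_zero_iff]
    intro h
    have h1 : ‖((p : ℚ_[p])⁻¹)‖ ≤ 1 := h
    rw [norm_inv, Padic.norm_p, inv_inv] at h1
    have : (1 : ℝ) < p := by exact_mod_cast (Fact.out : p.Prime).one_lt
    linarith
  obtain ⟨c, hc⟩ := CharacterModule.exists_character_apply_ne_zero_of_ne_zero hne
  let f : ℚ_[p] →+ AddCircle (1 : ℝ) :=
    ratCircleToReal.comp ((c : _ →+ AddCircle (1 : ℚ)).comp (QuotientAddGroup.mk' U))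
  have hf : Continuous f := by
    have h1 : Continuous fun y : ℚ_[p] ⧸ U => ratCircleToReal (c y) :=
      continuous_of_discreteTopology
    exact h1.comp continuous_quotient_mk'
  refine ⟨⟨fun x => AddCircle.toCircle (f x), by simp, fun x y => by
    rw [map_add, AddCircle.toCircle_add]⟩, ?_, (p : ℚ_[p])⁻¹, ?_⟩
  · exact AddCircle.continuous_toCircle.comp hf
  · intro h
    have h1 : AddCircle.toCircle (f (p : ℚ_[p])⁻¹) = AddCircle.toCircle (0 : AddCircle (1 : ℝ)) := by
      rw [AddCircle.toCircle_zero]; exact h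
    have h2 := AddCircle.injective_toCircle one_ne_zero h1
    exact hc (ratCircleToReal_injective (h2.trans (map_zero _).symm))

lemma exists_real_character : ∃ ψ : AddChar ℝ Circle, Continuous ψ ∧ ∃ c, ψ c ≠ 1 := by
  exact ⟨Real.probChar, Real.continuous_probChar,
    by simpa using! DFunLike.ne_iff.1 Real.probChar_ne_one⟩

end FieldCharacters

/-! ### Contractions as matrices over a field in which `ℚ` is dense. -/

section Linear

variable {𝕜 : Type*} [NontriviallyNormedField 𝕜]

/-- The operator norm is at most the sum of the norms of the images of the standard basis vectors.
-/
lemma tendsto_zero_of_forall_apply {d : ℕ} {f : ℕ → (Fin d → 𝕜) →L[𝕜] (Fin d → 𝕜)}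
    (hf : ∀ x, Tendsto (fun n => f n x) atTop (𝓝 0)) : Tendsto f atTop (𝓝 0) := by
  refine squeeze_zero_norm (a := fun n => ∑ i, ‖f n (Pi.single i 1)‖) (fun n => ?_) ?_
  · refine ContinuousLinearMap.opNorm_le_bound _ (Finset.sum_nonneg fun _ _ => norm_nonneg _) ?_
    intro x
    have hx : f n x = ∑ i, x i • f n (Pi.single i 1) := by
      conv_lhs => rw [pi_eq_sum_univ' x]
      simp only [map_sum, map_smul]
    rw [hx, Finset.sum_mul]
    refine (norm_sum_le _ _).trans (Finset.sum_le_sum fun i _ => ?_)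
    rw [norm_smul, mul_comm]
    exact mul_le_mul_of_nonneg_left (norm_le_pi_norm x i) (norm_nonneg _)
  · have := tendsto_finsetSum (Finset.univ : Finset (Fin d))
      fun i _ => (hf (Pi.single i 1)).norm
    simpa using this

lemma exists_character_ne_one {V : Type*} [AddCommGroup V] [TopologicalSpace V]
    [Module 𝕜 V] {d : ℕ} (e : V ≃L[𝕜] (Fin d → 𝕜))
    {ψ : AddChar 𝕜 Circle} (hψ : Continuous ψ) {c : 𝕜} (hc : ψ c ≠ 1)
    {x : V} (hx : x ≠ 0) : ∃ χ : AddChar V Circle, Continuous χ ∧ χ x ≠ 1 := by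
  have hex : e x ≠ 0 := by simpa using hx
  obtain ⟨i, hi⟩ := Function.ne_iff.1 hex
  let f : V →L[𝕜] 𝕜 :=
    ((e x i)⁻¹ * c) • ((ContinuousLinearMap.proj i).comp (e : V →L[𝕜] (Fin d → 𝕜)))
  refine ⟨ψ.compAddMonoidHom (f : V →ₗ[𝕜] 𝕜).toAddMonoidHom, hψ.comp f.continuous, ?_⟩
  have hfx : f x = c := by
    change (e x i)⁻¹ * c * e x i = c
    rw [mul_right_comm, inv_mul_cancel₀ (show e x i ≠ 0 from hi), one_mul]
  change ψ (f x) ≠ 1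
  rwa [hfx]

variable {V : Type*} [AddCommGroup V] [TopologicalSpace V] [Module 𝕜 V] [ContinuousSMul 𝕜 V]
  [T2Space V]

/-- Continuous additive automorphisms are linear over a field in which `ℚ` is dense. -/
def toContinuousLinear (hdense : DenseRange ((↑) : ℚ → 𝕜)) (T : V ≃ₜ+ V) : V →L[𝕜] V where
  toFun := T
  map_add' := map_add T
  map_smul' c x := by
    have hT : Continuous T := T.continuous_toFun
    refine isClosed_property (p := fun c : 𝕜 => T (c • x) = c • T x) hdense
      (isClosed_eq (by fun_prop) (by fun_prop)) (fun q => ?_) c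
    exact map_ratCast_smul T 𝕜 𝕜 q x
  cont := T.continuous_toFun

/-- A continuous additive automorphism, in coordinates. -/
def inCoordinates {d : ℕ} (e : V ≃L[𝕜] (Fin d → 𝕜))
    (hdense : DenseRange ((↑) : ℚ → 𝕜)) (T : V ≃ₜ+ V) : (Fin d → 𝕜) →L[𝕜] (Fin d → 𝕜) :=
  ((e : V →L[𝕜] (Fin d → 𝕜)).comp (toContinuousLinear hdense T)).comp
    (e.symm : (Fin d → 𝕜) →L[𝕜] V)

lemma inCoordinates_apply {d : ℕ} (e : V ≃L[𝕜] (Fin d → 𝕜))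
    (hdense : DenseRange ((↑) : ℚ → 𝕜)) (T : V ≃ₜ+ V) (x : V) :
    inCoordinates e hdense T (e x) = e (T x) := by
  change e (T (e.symm (e x))) = e (T x)
  rw [e.symm_apply_apply]

lemma inCoordinates_pow_apply {d : ℕ} (e : V ≃L[𝕜] (Fin d → 𝕜))
    (hdense : DenseRange ((↑) : ℚ → 𝕜)) (T : V ≃ₜ+ V) (n : ℕ) (x : V) :
    (inCoordinates e hdense T ^ n) (e x) = e ((⇑T)^[n] x) := by
  induction n generalizing x with
  | zero => rfl
  | succ n ih =>
    rw [pow_succ, Function.iterate_succ_apply, ← ih, ← inCoordinates_apply]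
    rfl

lemma tendsto_inCoordinates_pow {d : ℕ} (e : V ≃L[𝕜] (Fin d → 𝕜))
    (hdense : DenseRange ((↑) : ℚ → 𝕜)) {T : V ≃ₜ+ V} (hT : IsContraction T) :
    Tendsto (fun n => inCoordinates e hdense T ^ n) atTop (𝓝 0) := by
  refine tendsto_zero_of_forall_apply fun y => ?_
  obtain ⟨x, rfl⟩ := e.surjective y
  simp only [inCoordinates_pow_apply]
  have := (e.continuous.tendsto 0).comp (hT x)
  rwa [map_zero] at this

/-- Norm convergence of the powers and joint continuity of evaluation make the contraction uniform
on compact sets. -/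
lemma eventually_iterate_mem_of_isCompact {d : ℕ} (e : V ≃L[𝕜] (Fin d → 𝕜))
    (hdense : DenseRange ((↑) : ℚ → 𝕜)) {T : V ≃ₜ+ V} (hT : IsContraction T) {K : Set V}
    (hK : IsCompact K) {U : Set V} (hU : U ∈ 𝓝 (0 : V)) :
    ∀ᶠ n : ℕ in atTop, ∀ x ∈ K, (⇑T)^[n] x ∈ U := by
  have hcont : Continuous fun z : ((Fin d → 𝕜) →L[𝕜] (Fin d → 𝕜)) × V => e.symm (z.1 (e z.2)) :=
    e.symm.continuous.comp (continuous_fst.clm_apply (e.continuous.comp continuous_snd))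
  have h : ∀ᶠ f in 𝓝 (0 : (Fin d → 𝕜) →L[𝕜] (Fin d → 𝕜)), ∀ x ∈ K, e.symm (f (e x)) ∈ U := by
    refine hK.eventually_forall_of_forall_eventually fun x _ => ?_
    refine hcont.continuousAt.eventually_mem ?_
    simpa using hU
  filter_upwards [(tendsto_inCoordinates_pow e hdense hT).eventually h] with n hn x hx
  have := hn x hx
  rwa [inCoordinates_pow_apply, e.symm_apply_apply] at this

lemma tendsto_iterComp {d : ℕ} (e : V ≃L[𝕜] (Fin d → 𝕜))
    (hdense : DenseRange ((↑) : ℚ → 𝕜)) {m : ℕ} {T : Fin m → (V ≃ₜ+ V)}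
    (hT : ∀ i, IsContraction (T i)) (hcomm : ∀ i j x, T i (T j x) = T j (T i x))
    (s : ℕ → Fin m) (x : V) :
    Tendsto (fun N => iterComp T s N x) atTop (𝓝 0) := by
  let a : Fin m → (Fin d → 𝕜) →L[𝕜] (Fin d → 𝕜) := fun i => inCoordinates e hdense (T i)
  let p : ℕ → (Fin d → 𝕜) →L[𝕜] (Fin d → 𝕜) :=
    fun N => Nat.rec 1 (fun N q => q * a (s N)) N
  have hp : Tendsto p atTop (𝓝 0) := by
    refine tendsto_prod_of_commute (a := a) (fun i j => ?_)
      (fun i => tendsto_inCoordinates_pow e hdense (hT i)) s rfl fun _ => rfl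
    ext1 y
    obtain ⟨y, rfl⟩ := e.surjective y
    change a i (a j (e y)) = a j (a i (e y))
    simp only [a, inCoordinates_apply, hcomm i j]
  have hpx : ∀ N y, p N (e y) = e (iterComp T s N y) := by
    intro N
    induction N with
    | zero => intro y; rfl
    | succ N ih =>
      intro y
      change p N (a (s N) (e y)) = e (iterComp T s N (T (s N) y))
      rw [← ih, inCoordinates_apply]
  have h1 : Tendsto (fun N => e.symm (p N (e x))) atTop (𝓝 0) := by
    have h2 : Continuous fun f : (Fin d → 𝕜) →L[𝕜] (Fin d → 𝕜) => e.symm (f (e x)) :=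
      e.symm.continuous.comp (continuous_id.clm_apply continuous_const)
    have := (h2.tendsto 0).comp hp
    simpa [Function.comp_def] using this
  simpa only [hpx, e.symm_apply_apply] using h1

lemma polishSpace_of_finiteDimensional (𝕜 V : Type*) [NontriviallyNormedField 𝕜] [ProperSpace 𝕜]
    [AddCommGroup V] [TopologicalSpace V] [IsTopologicalAddGroup V] [Module 𝕜 V]
    [ContinuousSMul 𝕜 V] [T2Space V] [FiniteDimensional 𝕜 V] : PolishSpace V :=
  (Module.finBasis 𝕜 V).equivFunL.toHomeomorph.isClosedEmbedding.polishSpace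

end Linear

/-! ### Assembly of the two conclusions. -/

section Main

variable {V : Type*} [AddCommGroup V] [TopologicalSpace V] [IsTopologicalAddGroup V]
  [MeasurableSpace V] [BorelSpace V]

lemma infinitelyDivisible_of_forall [PolishSpace V] {μ : ProbabilityMeasure V}
    (h : ∀ n : ℕ, n ≠ 0 → ∃ σ : ProbabilityMeasure V, n • σ = μ) :
    InfinitelyDivisible (μ : Measure V) := by
  intro n hn
  obtain ⟨σ, hσ⟩ := h n (by omega)
  exact ⟨σ, inferInstance, by rw [convPow_toMeasure, hσ]⟩

lemma noIdempotentFactors_of_charInt_ne_zero [T2Space V] [SecondCountableTopology V]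
    {μ : ProbabilityMeasure V}
    (hsep : ∀ x : V, x ≠ 0 → ∃ χ : AddChar V Circle, Continuous χ ∧ χ x ≠ 1)
    (h : ∀ χ : AddChar V Circle, Continuous χ → charInt χ μ ≠ 0) :
    NoIdempotentFactors (μ : Measure V) := by
  rintro ν ⟨hν, ρ, hρ, hμ⟩ hidem
  let ν' : ProbabilityMeasure V := ⟨ν, hν⟩
  let ρ' : ProbabilityMeasure V := ⟨ρ, hρ⟩
  have hμ' : μ = ν' + ρ' := Subtype.ext hμ
  have hidem' : ν' + ν' = ν' := Subtype.ext hidem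
  have h0 : ν' = 0 := by
    refine eq_zero_of_charInt_eq_one hsep fun χ hχ => ?_
    have h1 := h χ hχ
    rw [hμ', charInt_add hχ] at h1
    have h2 : charInt χ ν' * charInt χ ν' = charInt χ ν' := by rw [← charInt_add hχ, hidem']
    -- The transform of a factor divides that of `μ`, so it is a nonzero idempotent number, namely
    -- `1`.
    exact mul_left_cancel₀ (left_ne_zero_of_mul h1) (by rw [h2, mul_one])
  exact congrArg ProbabilityMeasure.toMeasure h0

/-- The main result over a locally compact field in which `ℚ` is dense and which has a nontrivial
unitary character. -/
theorem infinitelyDivisible_and_noIdempotentFactors (𝕜 : Type*) [NontriviallyNormedField 𝕜]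
    [ProperSpace 𝕜] [CharZero 𝕜] (hdense : DenseRange ((↑) : ℚ → 𝕜))
    (hψ : ∃ ψ : AddChar 𝕜 Circle, Continuous ψ ∧ ∃ c, ψ c ≠ 1)
    [T2Space V] [Module 𝕜 V] [ContinuousSMul 𝕜 V] [FiniteDimensional 𝕜 V]
    (μ : Measure V) [IsProbabilityMeasure μ] {m : ℕ} (T : Fin m → (V ≃ₜ+ V))
    (hT : ∀ i, IsContraction (T i)) (hcomm : ∀ i j x, T i (T j x) = T j (T i x))
    (hμ : μ = convList (List.ofFn fun i => μ.map (T i))) :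
    InfinitelyDivisible μ ∧ NoIdempotentFactors μ := by
  let e : V ≃L[𝕜] (Fin (Module.finrank 𝕜 V) → 𝕜) := (Module.finBasis 𝕜 V).equivFunL
  have : PolishSpace V := polishSpace_of_finiteDimensional 𝕜 V
  let μ' : ProbabilityMeasure V := ⟨μ, inferInstance⟩
  have hμ' : (∑ i, push (T i)) μ' = μ' := Subtype.ext <| by
    rw [← ProbabilityMeasure.toMeasure, ← convList_ofFn_map]
    exact hμ.symm
  have hd : ∀ n : ℕ, n ≠ 0 → ∃ d : V → V, Continuous d ∧ ∀ x, d (n • x) = x := by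
    intro n hn
    refine ⟨fun x => (n : 𝕜)⁻¹ • x, continuous_const_smul _, fun x => ?_⟩
    rw [← Nat.cast_smul_eq_nsmul 𝕜]
    exact inv_smul_smul₀ (Nat.cast_ne_zero.2 hn : (n : 𝕜) ≠ 0) x
  obtain ⟨ψ, hψc, c, hc⟩ := hψ
  constructor
  · refine infinitelyDivisible_of_forall (μ := μ') fun n hn => ?_
    obtain ⟨P, R, hPR, hR⟩ := exists_approximate_root hd
      (fun i K hK U hU => eventually_iterate_mem_of_isCompact e hdense (hT i) hK hU)
      hcomm hμ' n hn
    exact exists_nsmul_eq_of_tendsto hn (hd n hn) hPR hR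
  · exact noIdempotentFactors_of_charInt_ne_zero (μ := μ')
      (fun x hx => exists_character_ne_one e hψc hc hx)
      fun χ hχ => charInt_ne_zero (tendsto_iterComp e hdense hT hcomm) hμ' hχ

end Main

end Autophage

theorem theorem4p3 {V : Type*} [AddCommGroup V] [TopologicalSpace V] [IsTopologicalAddGroup V]
    [T2Space V] [MeasurableSpace V] [BorelSpace V]
    (hV : Autophage.IsFiniteDimRealOrPadic V)
    (μ : Measure V) [IsProbabilityMeasure μ] :
    (∀ (m : ℕ) (T : Fin m → (V ≃ₜ+ V)),
      (∀ i, Autophage.IsContraction (T i)) →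
      (∀ i j x, T i (T j x) = T j (T i x)) →
      μ = Autophage.convList (List.ofFn fun i => μ.map (T i)) →
      Autophage.InfinitelyDivisible μ ∧ Autophage.NoIdempotentFactors μ) ∧
    (Autophage.IsAutophage μ →
      Autophage.InfinitelyDivisible μ ∧ Autophage.NoIdempotentFactors μ) := by
  have main : ∀ (m : ℕ) (T : Fin m → (V ≃ₜ+ V)),
      (∀ i, Autophage.IsContraction (T i)) →
      (∀ i j x, T i (T j x) = T j (T i x)) →
      μ = Autophage.convList (List.ofFn fun i => μ.map (T i)) →
      Autophage.InfinitelyDivisible μ ∧ Autophage.NoIdempotentFactors μ := by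
    intro m T hT hcomm hμ
    rcases hV with ⟨_, _, _⟩ | ⟨p, _, _, _, _⟩
    · exact Autophage.infinitelyDivisible_and_noIdempotentFactors ℝ Rat.denseRange_cast
        Autophage.exists_real_character μ T hT hcomm hμ
    · exact Autophage.infinitelyDivisible_and_noIdempotentFactors ℚ_[p] (Padic.denseRange_ratCast p)
        (Autophage.exists_padic_character p) μ T hT hcomm hμ
  refine ⟨main, ?_⟩
  rintro ⟨T, S, hT, hS, hTS, hμ⟩
  refine main 2 ![T, S] ?_ ?_ ?_
  · intro i
    fin_cases i
    · exact hT
    · exact hS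
  · intro i j x
    fin_cases i <;> fin_cases j
    · rfl
    · exact hTS x
    · exact (hTS x).symm
    · rfl
  · have hprob : IsProbabilityMeasure (μ.map S) :=
      Measure.isProbabilityMeasure_map S.continuous_toFun.measurable.aemeasurable
    have : PolishSpace V := by
      rcases hV with ⟨_, _, _⟩ | ⟨p, _, _, _, _⟩
      · exact Autophage.polishSpace_of_finiteDimensional ℝ V
      · exact Autophage.polishSpace_of_finiteDimensional ℚ_[p] V
    -- The fold in `convList` ends in `δ_0`, so the two-term equation is padded to match it.
    rw [← Measure.conv_dirac_zero (μ.map S)] at hμ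
    exact hμ
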